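/- Let $n, d, r$ be positive integers with $r \ge 3$ and $n \ge 2d$. For $j \in \mathbb{Z}$ let $\boldsymbol{e}_j \in \mathbb{Z}_2^n$ be the standard basis vector whose subscript is taken modulo $n$. The general recursive cube of rings $Q_n^-(d,r)$ (the network RCR-II$(d,r,n-d)$) is the graph with vertex set $\mathbb{Z}_2^n \times \mathbb{Z}_r$, where $\mathbb{Z}_r$ is represented by $\{0, 1, \ldots, r-1\}$, in which $(\boldsymbol{a},x)$ and $(\boldsymbol{b},y)$ are adjacent if and only if either $\boldsymbol{a} = \boldsymbol{b}$ and $x \equiv y \pm 1 \pmod r$, or $x = y$ and $\boldsymbol{b} = \boldsymbol{a} + \boldsymbol{e}_{i-dx}$ for some $i$ with $1 \le i \le d$. Then $Q_n^-(d,r)$ is a connected Cayley graph (that is, it is connected and isomorphic to $\mathrm{Cay}(G,S)$ for some group $G$ and some inverse-closed $S \subseteq G$ not containing the identity) if and only if $dr \equiv 0 \pmod n$. -/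

import Mathlib

universe u

/-- A graph is a Cayley graph if it is isomorphic to `Cay(G, S)` for some group `G` and some
connection set `S ⊆ G` with `1 ∉ S` and `S` closed under inverses.  For such an `S`, vertices
`g` and `h` are adjacent in `SimpleGraph.mulCayley S` exactly when `g⁻¹ * h ∈ S`. -/
def IsCayleyGraph {V : Type u} (X : SimpleGraph V) : Prop :=
  ∃ (G : Type u) (_ : Group G) (S : Set G),
    1 ∉ S ∧ (∀ s ∈ S, s⁻¹ ∈ S) ∧ Nonempty (X ≃g SimpleGraph.mulCayley S)

/-- The standard basis vector `e_j` of `ℤ₂ⁿ`, with the subscript `j` taken modulo `n`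
(so that `e_0` means `e_n`). -/
def stdVec (n : ℕ) (j : ZMod n) : ZMod n → ZMod 2 :=
  Pi.single j 1

/-- The general recursive cube of rings `Q_n^-(d, r)`, on the vertex set `ℤ₂ⁿ × ℤ_r`.
The coordinates of `ℤ₂ⁿ` are indexed by the residues modulo `n`.  There are ring edges
`(a, x) ~ (a, x ± 1)` and cube edges `(a, x) ~ (a + e_{i - d x}, x)` for `1 ≤ i ≤ d`, where in the
subscript `x` stands for its representative in `{0, …, r - 1}`.
The condition `u ≠ v` only removes the loops that would occur for `r = 1`. -/
def generalRCR (n d r : ℕ) : SimpleGraph ((ZMod n → ZMod 2) × ZMod r) where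
  Adj u v := u ≠ v ∧
    ((u.1 = v.1 ∧ (u.2 = v.2 + 1 ∨ u.2 = v.2 - 1)) ∨
      (u.2 = v.2 ∧ ∃ i : ℕ, 1 ≤ i ∧ i ≤ d ∧
        v.1 = u.1 + stdVec n ((i : ZMod n) - (d : ZMod n) * (u.2.val : ZMod n))))
  symm := ⟨by
    rintro ⟨a, x⟩ ⟨b, y⟩ ⟨hne, h⟩
    refine ⟨hne.symm, ?_⟩
    rcases h with ⟨hab, hxy⟩ | ⟨hxy, i, h1, h2, hb⟩
    · refine Or.inl ⟨hab.symm, ?_⟩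
      rcases hxy with h | h
      · right
        simp only at h ⊢
        rw [h]
        ring
      · left
        simp only at h ⊢
        rw [h]
        ring
    · refine Or.inr ⟨hxy.symm, i, h1, h2, ?_⟩
      simp only at hxy hb ⊢
      subst hxy
      rw [hb, add_assoc]
      funext k
      simp [CharTwo.add_self_eq_zero]⟩
  loopless := ⟨fun _ h => h.1 rfl⟩

/-! At level `x` the cube edges flip the window of coordinates `1 - dx, …, d - dx`. If `n ∣ dr`,
then `x ↦ dx` is a homomorphism `ℤ_r → ℤ_n`, so `ℤ_r` acts on `ℤ₂ⁿ` by rotations and the semidirect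
product carries the Cayley structure. Connectedness amounts to the windows covering all coordinates,
that is, to `n ≤ dr`.

Conversely, let `n ≤ dr` with `n ∤ dr`, and put `t = dr mod n`. The windows follow one another
regularly on levels `0, …, r - 1`, but the seam between `r - 1` and `0` shifts the pattern by `t`.
Take `k = max 1 ⌊t/d⌋` and compare closed walks of length `2k + 2` from levels `k` and `0`. By
parity such a walk has no cube move or at least two; in the latter case it has at most `2k` ring
moves, and from level `k` it stays in `0, …, 2k`, away from the seam. Permuting the cube moves level
by level sends these words injectively to closed words at level `0` (`relabel_mem_closedWords`), but
misses a detour across the seam. Level `0` thus has strictly more closed walks, and no automorphism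
joins the two levels (`not_exists_iso_of_relabel`). -/

/-! ### Vertex-transitivity of Cayley graphs -/

/-- Left translations of a Cayley graph act transitively on the vertices. -/
theorem IsCayleyGraph.exists_iso {V : Type u} {X : SimpleGraph V} (hX : IsCayleyGraph X)
    (u v : V) : ∃ φ : X ≃g X, φ u = v := by
  obtain ⟨G, _, S, -, -, ⟨ψ⟩⟩ := hX
  let τ : SimpleGraph.mulCayley S ≃g SimpleGraph.mulCayley S :=
    { toEquiv := Equiv.mulLeft (ψ v * (ψ u)⁻¹)
      map_rel_iff' := by
        intro a b
        exact SimpleGraph.mulCayley_adj_mul_iff_right }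
  refine ⟨(ψ.trans τ).trans ψ.symm, ?_⟩
  have h : τ (ψ u) = ψ v := by
    change ψ v * (ψ u)⁻¹ * ψ u = ψ v
    group
  simp [h]

/-! ### Transport of sums of standard basis vectors -/

/-- A vanishing sum of standard basis vectors still vanishes after a change of subscripts that
identifies all subscripts that were equal. -/
theorem sum_stdVec_transfer {n : ℕ} [NeZero n] {α : Type*} (l : List α) (f g : α → ZMod n)
    (hfg : ∀ p ∈ l, ∀ q ∈ l, f p = f q → g p = g q)
    (h : (l.map fun p => stdVec n (f p)).sum = 0) :
    (l.map fun p => stdVec n (g p)).sum = 0 := by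
  classical
  let k : ZMod n → ZMod n := fun j =>
    if hj : ∃ p ∈ l, f p = j then g hj.choose else 0
  have hk : ∀ p ∈ l, k (f p) = g p := by
    intro p hp
    have hj : ∃ q ∈ l, f q = f p := ⟨p, hp, rfl⟩
    simp only [k, dif_pos hj]
    exact hfg _ hj.choose_spec.1 _ hp hj.choose_spec.2
  -- The linear map `e_j ↦ e_{k j}` carries one sum to the other.
  let T := (Pi.basisFun (ZMod 2) (ZMod n)).constr ℕ fun j => stdVec n (k j)
  have hT : ∀ j, T (stdVec n j) = stdVec n (k j) := by
    intro j
    simp [T, stdVec]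
  have h2 := congrArg T h
  rw [map_zero, map_list_sum, List.map_map] at h2
  rw [← h2]
  congr 1
  refine List.map_congr_left fun p hp => ?_
  simp [hT, hk p hp]

/-- A vanishing sum of standard basis vectors has an even number of terms. -/
theorem even_length_of_sum_stdVec {n : ℕ} [NeZero n] {α : Type*} (l : List α) (f : α → ZMod n)
    (h : (l.map fun p => stdVec n (f p)).sum = 0) : Even l.length := by
  -- The sum of the coordinates counts the terms modulo 2.
  let T := (Pi.basisFun (ZMod 2) (ZMod n)).constr ℕ fun _ => (1 : ZMod 2)
  have hT : ∀ j, T (stdVec n j) = 1 := by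
    intro j
    simp [T, stdVec]
  have h2 := congrArg T h
  rw [map_zero, map_list_sum, List.map_map] at h2
  have h3 : (l.map (T ∘ fun p => stdVec n (f p))).sum = (l.length : ZMod 2) := by
    rw [List.map_congr_left (g := fun _ => (1 : ZMod 2)) fun p _ => by simp [hT]]
    simp
  rw [h3] at h2
  exact (ZMod.natCast_eq_zero_iff_even).1 h2

theorem stdVec_injective (n : ℕ) : Function.Injective (stdVec n) := by
  intro i j h
  by_contra hij
  have := congrFun h i
  simp [stdVec, Pi.single_eq_of_ne hij] at this

theorem stdVec_ne_zero (n : ℕ) (j : ZMod n) : stdVec n j ≠ 0 := by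
  intro h
  have := congrFun h j
  simp [stdVec] at this

theorem stdVec_add_self (n : ℕ) (j : ZMod n) : stdVec n j + stdVec n j = 0 := by
  funext k
  simp [CharTwo.add_self_eq_zero]

theorem eq_of_stdVec_add_eq_zero {n : ℕ} {i j : ZMod n} (h : stdVec n i + stdVec n j = 0) :
    i = j := by
  refine stdVec_injective n ?_
  have h2 := stdVec_add_self n j
  rw [← h2] at h
  exact add_right_cancel h

/-! ### Words of moves

A move is either a ring move (up for `true`, down for `false`) or one of `d` cube moves. -/

/-- The displacement of a ring move. -/
def ringSign (b : Bool) : ℤ := if b then 1 else -1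

/-- The total displacement along the ring of a word of moves. -/
def wordTotal {d : ℕ} : List (Bool ⊕ Fin d) → ℤ
  | [] => 0
  | Sum.inl b :: w => ringSign b + wordTotal w
  | Sum.inr _ :: w => wordTotal w

/-- The number of ring moves of a word. -/
def wordRings {d : ℕ} : List (Bool ⊕ Fin d) → ℕ
  | [] => 0
  | Sum.inl _ :: w => wordRings w + 1
  | Sum.inr _ :: w => wordRings w

/-- The cube moves of a word, each with the height at which it is made, the word starting at
height `s`. -/
def wordCubes {d : ℕ} : ℤ → List (Bool ⊕ Fin d) → List (ℤ × Fin d)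
  | _, [] => []
  | s, Sum.inl b :: w => wordCubes (s + ringSign b) w
  | s, Sum.inr i :: w => (s, i) :: wordCubes s w

/-- Permute the cube moves of a word by a permutation depending on the height. -/
def wordRelabel {d : ℕ} (e : ℤ → Equiv.Perm (Fin d)) :
    ℤ → List (Bool ⊕ Fin d) → List (Bool ⊕ Fin d)
  | _, [] => []
  | s, Sum.inl b :: w => Sum.inl b :: wordRelabel e (s + ringSign b) w
  | s, Sum.inr i :: w => Sum.inr (e s i) :: wordRelabel e s w

section Words

variable {d : ℕ}

theorem abs_ringSign (b : Bool) : |ringSign b| = 1 := by cases b <;> simp [ringSign]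

theorem length_eq_wordRings_add (s : ℤ) (w : List (Bool ⊕ Fin d)) :
    w.length = wordRings w + (wordCubes s w).length := by
  induction w generalizing s with
  | nil => rfl
  | cons m w ih =>
    rcases m with b | i
    · simp only [List.length_cons, wordRings, wordCubes, ih (s + ringSign b)]
      omega
    · simp only [List.length_cons, wordRings, wordCubes, ih s]
      omega

theorem abs_wordTotal_le (w : List (Bool ⊕ Fin d)) : |wordTotal w| ≤ wordRings w := by
  induction w with
  | nil => simp [wordTotal, wordRings]
  | cons m w ih =>
    rcases m with b | i
    · have h1 := abs_add_le (ringSign b) (wordTotal w)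
      have h2 := abs_ringSign b
      simp only [wordTotal, wordRings]
      push_cast
      linarith
    · simpa [wordTotal, wordRings] using ih

theorem abs_height_le (s : ℤ) (w : List (Bool ⊕ Fin d)) :
    ∀ p ∈ wordCubes s w, |p.1 - s| + |s + wordTotal w - p.1| ≤ wordRings w := by
  induction w generalizing s with
  | nil => simp [wordCubes]
  | cons m w ih =>
    intro p hp
    rcases m with b | i
    · simp only [wordCubes] at hp
      have h1 := ih _ p hp
      have h2 := abs_ringSign b
      have h3 : p.1 - s = (p.1 - (s + ringSign b)) + ringSign b := by ring
      have h4 := abs_add_le (p.1 - (s + ringSign b)) (ringSign b)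
      rw [← h3] at h4
      simp only [wordTotal, wordRings]
      rw [← add_assoc]
      push_cast
      linarith
    · simp only [wordCubes, List.mem_cons] at hp
      simp only [wordTotal, wordRings]
      rcases hp with rfl | hp
      · have := abs_wordTotal_le w
        simpa using this
      · exact ih _ p hp

/-- The word visits both heights in one order or the other, and each leg costs at least its length
in ring moves. For a word of total zero this bounds the distance of the two heights by half the
number of ring moves. -/
theorem abs_height_pair_le (s : ℤ) (w : List (Bool ⊕ Fin d)) :
    ∀ p ∈ wordCubes s w, ∀ q ∈ wordCubes s w,
      |p.1 - s| + |q.1 - p.1| + |s + wordTotal w - q.1| ≤ wordRings w ∨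
      |q.1 - s| + |p.1 - q.1| + |s + wordTotal w - p.1| ≤ wordRings w := by
  induction w generalizing s with
  | nil => simp [wordCubes]
  | cons m w ih =>
    intro p hp q hq
    rcases m with b | i
    · simp only [wordCubes] at hp hq
      have h1 := ih _ p hp q hq
      have h2 := abs_ringSign b
      have h4 := abs_add_le (p.1 - (s + ringSign b)) (ringSign b)
      have h5 := abs_add_le (q.1 - (s + ringSign b)) (ringSign b)
      rw [show (p.1 - (s + ringSign b)) + ringSign b = p.1 - s by ring] at h4
      rw [show (q.1 - (s + ringSign b)) + ringSign b = q.1 - s by ring] at h5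
      simp only [wordTotal, wordRings]
      rw [← add_assoc]
      push_cast
      refine h1.imp (fun h => ?_) (fun h => ?_) <;> linarith
    · simp only [wordCubes, List.mem_cons] at hp hq
      simp only [wordTotal, wordRings]
      rcases hp with rfl | hp
      · rcases hq with rfl | hq
        · left
          have := abs_wordTotal_le w
          simpa using this
        · left
          have := abs_height_le s w q hq
          simpa using this
      · rcases hq with rfl | hq
        · right
          have := abs_height_le s w p hp
          simpa using this
        · exact ih _ p hp q hq

theorem wordTotal_relabel (e : ℤ → Equiv.Perm (Fin d)) (s : ℤ) (w : List (Bool ⊕ Fin d)) :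
    wordTotal (wordRelabel e s w) = wordTotal w := by
  induction w generalizing s with
  | nil => rfl
  | cons m w ih => rcases m with b | i <;> simp [wordTotal, wordRelabel, ih]

theorem length_wordRelabel (e : ℤ → Equiv.Perm (Fin d)) (s : ℤ) (w : List (Bool ⊕ Fin d)) :
    (wordRelabel e s w).length = w.length := by
  induction w generalizing s with
  | nil => rfl
  | cons m w ih => rcases m with b | i <;> simp [wordRelabel, ih]

theorem wordCubes_relabel (e : ℤ → Equiv.Perm (Fin d)) (s : ℤ) (w : List (Bool ⊕ Fin d)) :
    wordCubes s (wordRelabel e s w) = (wordCubes s w).map fun p => (p.1, e p.1 p.2) := by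
  induction w generalizing s with
  | nil => rfl
  | cons m w ih => rcases m with b | i <;> simp [wordCubes, wordRelabel, ih]

theorem wordRelabel_injective (e : ℤ → Equiv.Perm (Fin d)) (s : ℤ) :
    Function.Injective (wordRelabel e s) := by
  intro w
  induction w generalizing s with
  | nil =>
    intro w' h
    rcases w' with _ | ⟨_ | _, _⟩ <;> simp_all [wordRelabel]
  | cons m w ih =>
    intro w' h
    rcases m with b | i
    · rcases w' with _ | ⟨b' | i', w'⟩
      · simp [wordRelabel] at h
      · simp only [wordRelabel, List.cons.injEq, Sum.inl.injEq] at h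
        obtain ⟨rfl, h⟩ := h
        rw [ih _ h]
      · simp [wordRelabel] at h
    · rcases w' with _ | ⟨b' | i', w'⟩
      · simp [wordRelabel] at h
      · simp [wordRelabel] at h
      · simp only [wordRelabel, List.cons.injEq, Sum.inr.injEq, EmbeddingLike.apply_eq_iff_eq] at h
        obtain ⟨rfl, h⟩ := h
        rw [ih _ h]

theorem wordTotal_replicate_append (k : ℕ) (b : Bool) (w : List (Bool ⊕ Fin d)) :
    wordTotal (List.replicate k (Sum.inl b) ++ w) = k * ringSign b + wordTotal w := by
  induction k with
  | zero => simp
  | succ k ih =>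
    rw [List.replicate_succ, List.cons_append, wordTotal, ih]
    push_cast
    ring

theorem wordCubes_replicate_append (k : ℕ) (b : Bool) (s : ℤ) (w : List (Bool ⊕ Fin d)) :
    wordCubes s (List.replicate k (Sum.inl b) ++ w) = wordCubes (s + k * ringSign b) w := by
  induction k generalizing s with
  | zero => simp
  | succ k ih =>
    rw [List.replicate_succ, List.cons_append, wordCubes, ih]
    congr 1
    push_cast
    ring

/-- Cube move, `k` steps down, cube move, `k` steps up. -/
def detour (k : ℕ) (i j : Fin d) : List (Bool ⊕ Fin d) :=
  Sum.inr i :: (List.replicate k (Sum.inl false) ++ Sum.inr j ::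
    (List.replicate k (Sum.inl true) ++ []))

theorem wordTotal_detour (k : ℕ) (i j : Fin d) : wordTotal (detour k i j) = 0 := by
  -- The final `++ []` in `detour` must survive for the `replicate` lemma to apply.
  simp [detour, wordTotal, wordTotal_replicate_append, -List.append_nil, ringSign]

theorem wordCubes_detour (k : ℕ) (i j : Fin d) :
    wordCubes 0 (detour k i j) = [(0, i), (-(k : ℤ), j)] := by
  simp [detour, wordCubes, wordCubes_replicate_append, -List.append_nil, ringSign]

theorem length_detour (k : ℕ) (i j : Fin d) : (detour k i j).length = 2 * k + 2 := by
  simp [detour]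
  ring

end Words

/-! ### Moves in the general recursive cube of rings -/

/-- The end of the edge of the given kind at a vertex. -/
def rcrStep (n d r : ℕ) : Bool ⊕ Fin d → (ZMod n → ZMod 2) × ZMod r → (ZMod n → ZMod 2) × ZMod r
  | Sum.inl b, u => (u.1, u.2 + (ringSign b : ℤ))
  | Sum.inr i, u =>
    (u.1 + stdVec n (((i : ℕ) + 1 : ℕ) - (d : ZMod n) * (u.2.val : ZMod n)), u.2)

/-- The end of the walk described by a word of moves. -/
def rcrRun (n d r : ℕ) :
    List (Bool ⊕ Fin d) → (ZMod n → ZMod 2) × ZMod r → (ZMod n → ZMod 2) × ZMod r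
  | [], u => u
  | m :: w, u => rcrRun n d r w (rcrStep n d r m u)

/-- The direction of the cube move `p.2` at height `p.1` above the level `x`. -/
def cubeDir (n : ℕ) {d r : ℕ} (x : ZMod r) (p : ℤ × Fin d) : ZMod n :=
  (((p.2 : ℕ) + 1 : ℕ) : ZMod n) - (d : ZMod n) * ((x + (p.1 : ZMod r)).val : ZMod n)

theorem rcrRun_eq (n d r : ℕ) (w : List (Bool ⊕ Fin d)) (x : ZMod r) (a : ZMod n → ZMod 2)
    (s : ℤ) :
    rcrRun n d r w (a, x + s) =
      (a + ((wordCubes s w).map fun p => stdVec n (cubeDir n x p)).sum,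
        x + s + (wordTotal w : ℤ)) := by
  induction w generalizing a s with
  | nil => simp [rcrRun, wordCubes, wordTotal]
  | cons m w ih =>
    rcases m with b | i
    · have := ih a (s + ringSign b)
      push_cast at this
      simp only [rcrRun, rcrStep, wordCubes, wordTotal]
      rw [add_assoc x, this]
      push_cast
      simp only [add_assoc]
    · simp only [rcrRun, rcrStep, wordCubes, wordTotal]
      rw [ih, List.map_cons, List.sum_cons, ← add_assoc]
      rfl

theorem rcrRun_eq_self_iff (n d r : ℕ) (w : List (Bool ⊕ Fin d)) (x : ZMod r) :
    rcrRun n d r w (0, x) = (0, x) ↔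
      ((wordCubes 0 w).map fun p => stdVec n (cubeDir n x p)).sum = 0 ∧
        (r : ℤ) ∣ wordTotal w := by
  have := rcrRun_eq n d r w x 0 0
  rw [Int.cast_zero, add_zero] at this
  rw [this, Prod.mk.injEq, zero_add, add_eq_left, ZMod.intCast_zmod_eq_zero_iff_dvd]

theorem exists_move_of_adj {n d r : ℕ} {u v : (ZMod n → ZMod 2) × ZMod r}
    (h : (generalRCR n d r).Adj u v) : ∃ m, rcrStep n d r m u = v := by
  obtain ⟨a, x⟩ := u
  obtain ⟨b, y⟩ := v
  obtain ⟨-, ⟨hab, hxy | hxy⟩ | ⟨hxy, i, h1, h2, hb⟩⟩ := h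
  · refine ⟨Sum.inl false, ?_⟩
    simp only at hab hxy
    simp [rcrStep, ringSign, hab, hxy]
  · refine ⟨Sum.inl true, ?_⟩
    simp only at hab hxy
    simp [rcrStep, ringSign, hab, hxy]
  · refine ⟨Sum.inr ⟨i - 1, by omega⟩, ?_⟩
    simp only at hxy hb
    simp [rcrStep, ← hxy, hb, Nat.sub_add_cancel h1]

theorem zmod_one_ne_neg_one {r : ℕ} (hr : 3 ≤ r) : (1 : ZMod r) ≠ -1 := by
  intro h
  have h2 : ((2 : ℕ) : ZMod r) = 0 := by
    push_cast
    linear_combination h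
  rw [ZMod.natCast_eq_zero_iff] at h2
  have := Nat.le_of_dvd (by norm_num) h2
  omega

theorem ringSign_cast_ne_zero {r : ℕ} (hr : 3 ≤ r) (b : Bool) :
    ((ringSign b : ℤ) : ZMod r) ≠ 0 := by
  have : Fact (1 < r) := ⟨by omega⟩
  cases b <;> simp [ringSign]

/-- `r ≥ 3` separates up from down, and `d ≤ n` keeps the subscripts `1, …, d` distinct modulo `n`;
only `n` itself reduces to `0`. -/
theorem rcrStep_injective {n d r : ℕ} (hr : 3 ≤ r) (hn : d ≤ n)
    (u : (ZMod n → ZMod 2) × ZMod r) : Function.Injective fun m => rcrStep n d r m u := by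
  intro m m' h
  have h10 := zmod_one_ne_neg_one hr
  rcases m with b | i <;> rcases m' with b' | i' <;>
    simp only [rcrStep, Prod.mk.injEq, true_and, and_true, add_right_inj] at h
  · cases b <;> cases b' <;> simp_all [ringSign]
  · exact absurd (add_eq_left.1 h.2) (ringSign_cast_ne_zero hr b)
  · exact absurd (add_eq_left.1 h.2.symm) (ringSign_cast_ne_zero hr b')
  · have h1 := sub_left_injective (stdVec_injective n h)
    rw [ZMod.natCast_eq_natCast_iff'] at h1
    congr 1
    ext
    have hi := i.2
    have hi' := i'.2
    rcases Nat.lt_or_ge (i + 1) n with h2 | h2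
    · rcases Nat.lt_or_ge (i' + 1) n with h3 | h3
      · rw [Nat.mod_eq_of_lt h2, Nat.mod_eq_of_lt h3] at h1
        omega
      · have h4 : (i' : ℕ) + 1 = n := by omega
        rw [Nat.mod_eq_of_lt h2, h4, Nat.mod_self] at h1
        omega
    · have h4 : (i : ℕ) + 1 = n := by omega
      rcases Nat.lt_or_ge (i' + 1) n with h3 | h3
      · rw [Nat.mod_eq_of_lt h3, h4, Nat.mod_self] at h1
        omega
      · omega

theorem adj_rcrStep {n d r : ℕ} (hr : 3 ≤ r) (m : Bool ⊕ Fin d)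
    (u : (ZMod n → ZMod 2) × ZMod r) : (generalRCR n d r).Adj u (rcrStep n d r m u) := by
  obtain ⟨a, x⟩ := u
  rcases m with b | i
  · refine ⟨fun h => ?_, Or.inl ⟨rfl, ?_⟩⟩
    · simp only [rcrStep, Prod.mk.injEq, true_and] at h
      exact ringSign_cast_ne_zero hr b (add_eq_left.1 h.symm)
    · cases b <;> simp [rcrStep, ringSign]
  · refine ⟨fun h => ?_, Or.inr ⟨rfl, (i : ℕ) + 1, by omega, by omega, rfl⟩⟩
    simp only [rcrStep, Prod.mk.injEq, and_true] at h
    exact stdVec_ne_zero n _ (add_eq_left.1 h.symm)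

/-- The words of length `L` describing closed walks at `u`. -/
def closedWords (n d r L : ℕ) (u : (ZMod n → ZMod 2) × ZMod r) : Set (List (Bool ⊕ Fin d)) :=
  {w | w.length = L ∧ rcrRun n d r w u = u}

theorem finite_closedWords (n d r L : ℕ) (u : (ZMod n → ZMod 2) × ZMod r) :
    (closedWords n d r L u).Finite :=
  (List.finite_length_eq (Bool ⊕ Fin d) L).subset fun _ h => h.1

/-- Automorphisms carry closed walks to closed walks. -/
theorem exists_injOn_closedWords {n d r : ℕ} (hr : 3 ≤ r) (hn : d ≤ n) (L : ℕ)
    (φ : generalRCR n d r ≃g generalRCR n d r) (u : (ZMod n → ZMod 2) × ZMod r) :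
    ∃ T : List (Bool ⊕ Fin d) → List (Bool ⊕ Fin d),
      Set.MapsTo T (closedWords n d r L u) (closedWords n d r L (φ u)) ∧ Function.Injective T := by
  have hex : ∀ u m, ∃ m', rcrStep n d r m' (φ u) = φ (rcrStep n d r m u) := fun u m =>
    exists_move_of_adj (φ.map_adj_iff.2 (adj_rcrStep hr m u))
  choose f hf using hex
  have hfi : ∀ u, Function.Injective (f u) := by
    intro u m m' h
    refine rcrStep_injective hr hn u (φ.injective ?_)
    simp only [← hf, h]
  -- `T w u` is the word read along the `φ`-image of the walk `w` from `u`.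
  let T : List (Bool ⊕ Fin d) → (ZMod n → ZMod 2) × ZMod r → List (Bool ⊕ Fin d) := fun w =>
    List.rec (fun _ => []) (fun m _ ih u => f u m :: ih (rcrStep n d r m u)) w
  have hT0 : ∀ u, T [] u = [] := fun _ => rfl
  have hT1 : ∀ m w u, T (m :: w) u = f u m :: T w (rcrStep n d r m u) := fun _ _ _ => rfl
  have hlen : ∀ w u, (T w u).length = w.length := by
    intro w
    induction w with
    | nil => intro u; rfl
    | cons m w ih => intro u; simp [hT1, ih]
  have hrun : ∀ w u, rcrRun n d r (T w u) (φ u) = φ (rcrRun n d r w u) := by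
    intro w
    induction w with
    | nil => intro u; rfl
    | cons m w ih => intro u; simp [hT1, rcrRun, hf, ih]
  refine ⟨fun w => T w u, ?_, ?_⟩
  · rintro w ⟨h1, h2⟩
    exact ⟨(hlen w u).trans h1, by rw [hrun, h2]⟩
  · intro w
    induction w generalizing u with
    | nil =>
      intro w' h
      have := congrArg List.length h
      simp only [hlen, List.length_nil] at this
      exact (List.length_eq_zero_iff.1 this.symm).symm
    | cons m w ih =>
      intro w' h
      rcases w' with _ | ⟨m', w'⟩
      · simp [hT0, hT1] at h
      · simp only [hT1, List.cons.injEq] at h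
        obtain rfl := hfi u h.1
        rw [ih _ h.2]

/-- A word closing at level `k` closes at level `0` after relabelling. -/
theorem relabel_mem_closedWords {n d r k : ℕ} [NeZero n] (hk : 2 * k + 1 ≤ r)
    (e : ℤ → Equiv.Perm (Fin d))
    (he : ∀ p q : ℤ × Fin d, |p.1| ≤ k → |q.1| ≤ k → |p.1 - q.1| ≤ k →
      cubeDir n (k : ZMod r) p = cubeDir n (k : ZMod r) q →
      cubeDir n (0 : ZMod r) (p.1, e p.1 p.2) = cubeDir n (0 : ZMod r) (q.1, e q.1 q.2))
    {w : List (Bool ⊕ Fin d)} (hw : w ∈ closedWords n d r (2 * k + 2) (0, k)) :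
    wordRelabel e 0 w ∈ closedWords n d r (2 * k + 2) (0, 0) := by
  obtain ⟨hlen, hrun⟩ := hw
  rw [rcrRun_eq_self_iff] at hrun
  obtain ⟨hsum, htot⟩ := hrun
  refine ⟨(length_wordRelabel e 0 w).trans hlen, ?_⟩
  rw [rcrRun_eq_self_iff, wordTotal_relabel, wordCubes_relabel, List.map_map]
  refine ⟨?_, htot⟩
  refine sum_stdVec_transfer _ (cubeDir n (k : ZMod r)) _ ?_ hsum
  intro p hp q hq hpq
  -- A cube move `p` exists, so by parity there are at least two, leaving at most `2k < r` ring
  -- moves; hence the total, a multiple of `r`, is zero.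
  have heven := even_length_of_sum_stdVec _ _ hsum
  have hpos := List.length_pos_of_mem hp
  have hlr := length_eq_wordRings_add 0 w
  have hrings : (wordRings w : ℤ) ≤ 2 * k := by
    obtain ⟨c, hc⟩ := heven
    omega
  have h0 : wordTotal w = 0 := by
    refine Int.eq_zero_of_abs_lt_dvd htot ?_
    have := abs_wordTotal_le w
    omega
  have h1 := abs_height_le 0 w p hp
  have h2 := abs_height_le 0 w q hq
  have h3 := abs_height_pair_le 0 w p hp q hq
  simp only [h0, sub_zero, add_zero, zero_sub, abs_neg] at h1 h2 h3
  have h4 := abs_sub p.1 q.1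
  have h5 := abs_sub_comm p.1 q.1
  refine he p q (by linarith) (by linarith) ?_ hpq
  rcases h3 with h3 | h3 <;> linarith

/-- If relabelled closed words of level `k` miss a closed word of level `0`, then no automorphism
takes level `0` to level `k`. -/
theorem not_exists_iso_of_relabel {n d r k : ℕ} [NeZero n] (hr : 3 ≤ r) (hn : d ≤ n)
    (hk : 2 * k + 1 ≤ r) (e : ℤ → Equiv.Perm (Fin d))
    (he : ∀ p q : ℤ × Fin d, |p.1| ≤ k → |q.1| ≤ k → |p.1 - q.1| ≤ k →
      cubeDir n (k : ZMod r) p = cubeDir n (k : ZMod r) q →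
      cubeDir n (0 : ZMod r) (p.1, e p.1 p.2) = cubeDir n (0 : ZMod r) (q.1, e q.1 q.2))
    (i j : Fin d) (hij : cubeDir n (0 : ZMod r) (0, i) = cubeDir n (0 : ZMod r) (-(k : ℤ), j))
    (hne : ∀ i' j' : Fin d, e 0 i' = i →
      cubeDir n (k : ZMod r) (0, i') ≠ cubeDir n (k : ZMod r) (-(k : ℤ), j')) :
    ¬ ∃ φ : generalRCR n d r ≃g generalRCR n d r, φ (0, 0) = (0, (k : ZMod r)) := by
  rintro ⟨φ, hφ⟩
  obtain ⟨T, hT, hTi⟩ := exists_injOn_closedWords hr hn (2 * k + 2) φ (0, 0)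
  rw [hφ] at hT
  have hmaps : Set.MapsTo (fun w => wordRelabel e 0 (T w)) (closedWords n d r (2 * k + 2) (0, 0))
      (closedWords n d r (2 * k + 2) (0, 0)) := fun w hw =>
    relabel_mem_closedWords hk e he (hT hw)
  -- An injective self-map of a finite set is onto, so the detour has a preimage.
  have hsurj : Set.SurjOn (fun w => wordRelabel e 0 (T w)) (closedWords n d r (2 * k + 2) (0, 0))
      (closedWords n d r (2 * k + 2) (0, 0)) :=
    (Set.eq_of_subset_of_ncard_le hmaps.image_subset
      (Set.ncard_image_of_injective _ ((wordRelabel_injective e 0).comp hTi)).ge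
      (finite_closedWords n d r (2 * k + 2) (0, 0))).ge
  have hmem : detour k i j ∈ closedWords n d r (2 * k + 2) (0, 0) := by
    refine ⟨length_detour k i j, ?_⟩
    rw [rcrRun_eq_self_iff, wordTotal_detour, wordCubes_detour]
    simp [hij, stdVec_add_self]
  obtain ⟨w, hw, hwd⟩ := hsurj hmem
  have hTw := hT hw
  have hc := congrArg (wordCubes 0) hwd
  simp only [wordCubes_relabel, wordCubes_detour] at hc
  have hrun := hTw.2
  rw [rcrRun_eq_self_iff] at hrun
  obtain ⟨p, q, hpq⟩ : ∃ p q, wordCubes 0 (T w) = [p, q] := by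
    have := congrArg List.length hc
    simp only [List.length_map, List.length_cons, List.length_nil] at this
    exact List.length_eq_two.1 this
  rw [hpq] at hc hrun
  obtain ⟨p1, p2⟩ := p
  obtain ⟨q1, q2⟩ := q
  simp only [List.map_cons, List.map_nil, List.cons.injEq, Prod.mk.injEq, and_true] at hc
  obtain ⟨⟨rfl, hi⟩, rfl, -⟩ := hc
  refine hne p2 q2 hi (eq_of_stdVec_add_eq_zero ?_)
  simpa using hrun.1

/-! ### Levels across the wrap-around are distinguishable -/

theorem cubeDir_eq_of_level {n d r : ℕ} {x : ZMod r} {p : ℤ × Fin d} {y : ℤ} (h0 : 0 ≤ y)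
    (hy : y < r) (h : x + (p.1 : ZMod r) = (y : ZMod r)) :
    cubeDir n x p = (((p.2 : ℕ) + 1 - d * y : ℤ) : ZMod n) := by
  lift y to ℕ using h0
  rw [Int.cast_natCast] at h
  rw [cubeDir, h, ZMod.val_natCast_of_lt (by exact_mod_cast hy)]
  push_cast
  ring

theorem cubeDir_mid {n d r k : ℕ} (hk : 2 * k + 1 ≤ r) {s : ℤ} (hs : |s| ≤ k) (i : Fin d) :
    cubeDir n (k : ZMod r) (s, i) = (((i : ℕ) + 1 - d * (k + s) : ℤ) : ZMod n) := by
  have := abs_le.1 hs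
  refine cubeDir_eq_of_level (by omega) (by omega) ?_
  push_cast
  rfl

theorem cubeDir_zero_of_nonneg {n d r k : ℕ} (hk : 2 * k + 1 ≤ r) {s : ℤ} (h0 : 0 ≤ s)
    (hs : s ≤ k) (i : Fin d) :
    cubeDir n (0 : ZMod r) (s, i) = (((i : ℕ) + 1 - d * s : ℤ) : ZMod n) :=
  cubeDir_eq_of_level h0 (by omega) (zero_add _)

/-- Below level `0` the representative is `r + s`; the extra `dr` is the shift at the seam. -/
theorem cubeDir_zero_of_neg {n d r k : ℕ} (hk : 2 * k + 1 ≤ r) {s : ℤ} (h0 : s < 0)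
    (hs : -k ≤ s) (i : Fin d) :
    cubeDir n (0 : ZMod r) (s, i) = (((i : ℕ) + 1 - d * (r + s) : ℤ) : ZMod n) := by
  refine cubeDir_eq_of_level (by omega) (by omega) ?_
  simp

/-- The subscripts differ by at most `dk + d - 1 < n`, so congruence is equality, and division by
`d` recovers height and index. -/
theorem cubeDir_mid_injective {n d r k : ℕ} (hd : 1 ≤ d) (hk : 2 * k + 1 ≤ r)
    (hn : d * k + d ≤ n)
    {p q : ℤ × Fin d} (hp : |p.1| ≤ k) (hq : |q.1| ≤ k) (hpq : |p.1 - q.1| ≤ k)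
    (h : cubeDir n (k : ZMod r) p = cubeDir n (k : ZMod r) q) : p = q := by
  obtain ⟨s, i⟩ := p
  obtain ⟨s', i'⟩ := q
  simp only at hp hq hpq
  rw [cubeDir_mid hk hp, cubeDir_mid hk hq, ZMod.intCast_eq_intCast_iff_dvd_sub] at h
  have hi := i.2
  have hi' := i'.2
  have hd' : (0 : ℤ) ≤ d := by positivity
  have hb : |(d : ℤ) * (s - s')| ≤ d * k := by
    rw [abs_mul, abs_of_nonneg hd']
    exact mul_le_mul_of_nonneg_left hpq hd'
  have hb' := abs_le.1 hb
  have hn' : (d * k + d : ℤ) ≤ n := by exact_mod_cast hn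
  have h1 := Int.eq_zero_of_abs_lt_dvd h (by
    rw [abs_lt]
    constructor <;> linarith)
  have h2 : (d : ℤ) * (s - s') = i - i' := by linarith
  have h3 : (i - i' : ℤ) = 0 := by
    refine Int.eq_zero_of_abs_lt_dvd (Dvd.intro _ h2) ?_
    rw [abs_lt]
    constructor <;> omega
  rw [h3] at h2
  have h4 : s - s' = 0 := by
    rcases mul_eq_zero.1 h2 with h | h
    · omega
    · exact h
  ext
  · simpa using sub_eq_zero.1 h4
  · simp only
    omega

/-- The case where windows at distance at most `k` within the levels `0, …, r - 1` are disjoint. -/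
theorem not_exists_iso_of_disjoint {n d r k : ℕ} [NeZero n] (hd : 1 ≤ d) (hr : 3 ≤ r)
    (hk1 : 1 ≤ k) (hk : 2 * k + 1 ≤ r) (hn : d * k + d ≤ n) (i j : Fin d)
    (hij : (n : ℤ) ∣ j - d * (r - k) - i) :
    ¬ ∃ φ : generalRCR n d r ≃g generalRCR n d r, φ (0, 0) = (0, (k : ZMod r)) := by
  refine not_exists_iso_of_relabel hr (by omega) hk (fun _ => 1) ?_ i j ?_ ?_
  · intro p q hp hq hpq h
    rw [cubeDir_mid_injective hd hk hn hp hq hpq h]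
  · rw [cubeDir_zero_of_nonneg hk le_rfl (by omega), cubeDir_zero_of_neg hk (by omega) le_rfl,
      ZMod.intCast_eq_intCast_iff_dvd_sub]
    convert hij using 1
    ring
  · intro i' j' _ h
    have := cubeDir_mid_injective hd hk hn (by simp) (by simp) (by simp) h
    simp only [Prod.mk.injEq] at this
    omega

/-- The case where windows at distance `k` already meet within the levels `0, …, r - 1`. -/
theorem not_exists_iso_of_meet {n d r k t : ℕ} [NeZero n] (hr : 3 ≤ r)
    (hk : 2 * k + 1 ≤ r) (hn2 : 2 * d ≤ n) (hn : n < d * k + d) (htn : t < n) (hkt : d * k ≤ t)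
    (ht : (n : ℤ) ∣ t - d * r) :
    ¬ ∃ φ : generalRCR n d r ≃g generalRCR n d r, φ (0, 0) = (0, (k : ZMod r)) := by
  have hd : 0 < d := by
    rcases Nat.eq_zero_or_pos d with rfl | h
    · omega
    · exact h
  have : NeZero d := ⟨by omega⟩
  -- Away from the seam, windows at distance `k` overlap with index offset `n - dk`; across it the
  -- offset is `t - dk`. Shifting indices below level `0` by the difference `n - t` reconciles them.
  let c : Fin d := ⟨n - t, by omega⟩
  let e : ℤ → Equiv.Perm (Fin d) := fun s => if s < 0 then Equiv.subRight c else 1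
  have heneg : ∀ s < 0, ∀ i : Fin d, n - t ≤ i → ((e s i : ℕ) : ℤ) = i - (n - t) := by
    intro s hs i hi
    have : e s i = i - c := by simp [e, hs]
    rw [this, Fin.sub_val_of_le (by exact hi)]
    have : (c : ℕ) = n - t := rfl
    omega
  have hepos : ∀ s, 0 ≤ s → ∀ i : Fin d, e s i = i := by
    intro s hs i
    simp [e, not_lt.2 hs]
  have hn' : (n : ℤ) < d * k + d := by exact_mod_cast hn
  have hkt' : (d * k : ℤ) ≤ t := by exact_mod_cast hkt
  have hd' : (0 : ℤ) < d := by exact_mod_cast hd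
  -- As `dk ≤ t < n`, windows less than `k` levels apart are too close to meet around the cycle of
  -- coordinates.
  have key : ∀ (s s' : ℤ) (i i' : Fin d), |s| ≤ k → |s'| ≤ k → |s - s'| ≤ k →
      (i' - i - d * (s' - s) : ℤ) = n → s = s' + k ∧ (i' : ℤ) = i + n - d * k := by
    intro s s' i i' hs hs' hss h
    have hss' := abs_le.1 hss
    have hi := i.2
    have hi' := i'.2
    have h1 : s - s' = k := by
      by_contra hne
      have h2 : s - s' + 1 ≤ k := by omega
      have h3 := mul_le_mul_of_nonneg_left h2 hd'.le
      have h4 : (d : ℤ) * (s' - s) = - (d * (s - s')) := by ring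
      rw [mul_add, mul_one] at h3
      have : (i' : ℤ) < d := by omega
      have : (0 : ℤ) ≤ i := by omega
      linarith
    refine ⟨by omega, ?_⟩
    have h4 : (d : ℤ) * (s' - s) = - (d * (s - s')) := by ring
    rw [h4, h1] at h
    linarith
  have half : ∀ (s s' : ℤ) (i i' : Fin d), |s| ≤ k → |s'| ≤ k → |s - s'| ≤ k →
      (i' - i - d * (s' - s) : ℤ) = n →
      cubeDir n (0 : ZMod r) (s, e s i) = cubeDir n (0 : ZMod r) (s', e s' i') := by
    intro s s' i i' hs hs' hss h
    obtain ⟨h1, h2⟩ := key s s' i i' hs hs' hss h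
    have hs1 := abs_le.1 hs
    have hs1' := abs_le.1 hs'
    rw [cubeDir_zero_of_nonneg hk (by omega) hs1.2, hepos s (by omega)]
    rcases lt_or_ge s' 0 with h0 | h0
    · rw [cubeDir_zero_of_neg hk h0 hs1'.1, ZMod.intCast_eq_intCast_iff_dvd_sub,
        heneg s' h0 i' (by omega), h2, h1]
      convert ht using 1
      ring
    · rw [cubeDir_zero_of_nonneg hk h0 hs1'.2, hepos s' h0, ZMod.intCast_eq_intCast_iff_dvd_sub]
      refine ⟨1, ?_⟩
      rw [mul_one, ← h]
      ring
  -- The last index `d - 1` at height `-k` gives the missed detour: away from the seam its partner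
  -- would need index `d - 1 + (n - t) ≥ d`.
  refine not_exists_iso_of_relabel hr (by omega) hk e ?_ ⟨d - 1 - (t - d * k), by omega⟩
    ⟨d - 1, by omega⟩ ?_ ?_
  · rintro ⟨s, i⟩ ⟨s', i'⟩ hs hs' hss h
    simp only at hs hs' hss ⊢
    rw [cubeDir_mid hk hs, cubeDir_mid hk hs', ZMod.intCast_eq_intCast_iff_dvd_sub] at h
    obtain ⟨m, hm⟩ := h
    have hb : |(d : ℤ) * (s - s')| ≤ d * k := by
      rw [abs_mul, abs_of_pos hd']
      exact mul_le_mul_of_nonneg_left hss hd'.le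
    have hb' := abs_le.1 hb
    have hi := i.2
    have hi' := i'.2
    have hX : (i' - i + d * (s - s') : ℤ) = n * m := by
      rw [← hm]
      ring
    have hm1 : m < 2 := by
      by_contra hc
      have : (n : ℤ) * 2 ≤ n * m := mul_le_mul_of_nonneg_left (by omega) (by omega)
      omega
    have hm2 : -2 < m := by
      by_contra hc
      have : (n : ℤ) * m ≤ n * (-2) := mul_le_mul_of_nonneg_left (by omega) (by omega)
      omega
    obtain rfl | rfl | rfl : m = 0 ∨ m = 1 ∨ m = -1 := by omega
    · have h2 : (d : ℤ) * (s - s') = i - i' := by linarith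
      have h3 : (i - i' : ℤ) = 0 := by
        refine Int.eq_zero_of_abs_lt_dvd (Dvd.intro _ h2) ?_
        rw [abs_lt]
        constructor <;> omega
      rw [h3] at h2
      have h4 : s - s' = 0 := by
        rcases mul_eq_zero.1 h2 with h | h
        · omega
        · exact h
      obtain rfl : s = s' := by omega
      obtain rfl : i = i' := Fin.ext (by omega)
      rfl
    · refine half s s' i i' hs hs' hss ?_
      linarith
    · refine (half s' s i' i hs' hs (by rwa [abs_sub_comm]) ?_).symm
      linarith
  · rw [cubeDir_zero_of_nonneg hk le_rfl (by omega), cubeDir_zero_of_neg hk (by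
      rcases Nat.eq_zero_or_pos k with rfl | h
      · omega
      · omega) le_rfl, ZMod.intCast_eq_intCast_iff_dvd_sub]
    convert ht using 1
    have h1 : ((d - 1 : ℕ) : ℤ) = d - 1 := by omega
    have h2 : ((d - 1 - (t - d * k) : ℕ) : ℤ) = d - 1 - (t - d * k) := by
      have : ((t - d * k : ℕ) : ℤ) = t - d * k := by
        push_cast [Nat.cast_sub hkt]
        rfl
      omega
    rw [h1, h2]
    ring
  · intro i' j' hi h
    rw [hepos 0 le_rfl] at hi
    subst hi
    have hjd := j'.2
    rw [cubeDir_mid hk (by simp), cubeDir_mid hk (by simp), ZMod.intCast_eq_intCast_iff_dvd_sub]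
      at h
    have h1 : ((d - 1 - (t - d * k) : ℕ) : ℤ) = d - 1 - (t - d * k) := by
      have : ((t - d * k : ℕ) : ℤ) = t - d * k := by
        push_cast [Nat.cast_sub hkt]
        rfl
      omega
    simp only [h1, add_neg_cancel, add_zero, mul_zero] at h
    have h2 : (n : ℤ) ∣ j' - d + 1 + t := by
      convert h using 1
      ring
    have h3 := Int.eq_zero_of_abs_lt_dvd h2 (by rw [abs_lt]; constructor <;> omega)
    omega

/-- If the number of positions is not a multiple of `n`, then the general recursive cube of rings
is not vertex-transitive. -/
theorem exists_not_exists_iso {n d r : ℕ} (hd : 1 ≤ d) (hr : 3 ≤ r) (hn : 2 * d ≤ n)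
    (hle : n ≤ d * r) (hnd : ¬ n ∣ d * r) :
    ∃ k : ℕ, ¬ ∃ φ : generalRCR n d r ≃g generalRCR n d r, φ (0, 0) = (0, (k : ZMod r)) := by
  have : NeZero n := ⟨by omega⟩
  obtain ⟨t, ht⟩ : ∃ t, t = d * r % n := ⟨_, rfl⟩
  have htn : t < n := ht ▸ Nat.mod_lt _ (by omega)
  have ht0 : 0 < t := Nat.pos_of_ne_zero fun h => hnd (Nat.dvd_of_mod_eq_zero (by omega))
  have hdvd : (n : ℤ) ∣ t - d * r := by
    refine ⟨-((d * r / n : ℕ) : ℤ), ?_⟩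
    have h1 := congrArg (Nat.cast : ℕ → ℤ) (Nat.div_add_mod (d * r) n)
    rw [← ht, Nat.cast_add, Nat.cast_mul, Nat.cast_mul] at h1
    linear_combination h1
  -- The quotient is at least `1`, so `dr ≥ n + t > 2t`; this yields `2k + 1 ≤ r`.
  have h2t : 2 * t < d * r := by
    have := Nat.div_add_mod (d * r) n
    have h1 : 1 ≤ d * r / n := Nat.div_pos hle (by omega)
    have := Nat.mul_le_mul_left n h1
    omega
  rcases Nat.lt_or_ge t d with htd | htd
  · refine ⟨1, not_exists_iso_of_disjoint hd hr le_rfl hr (by omega) ⟨d - t, by omega⟩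
      ⟨0, by omega⟩ ?_⟩
    convert hdvd using 1
    push_cast [Nat.cast_sub htd.le]
    ring
  · obtain ⟨k, hk⟩ : ∃ k, k = t / d := ⟨_, rfl⟩
    have hk1 : 1 ≤ k := hk ▸ Nat.div_pos htd hd
    have hdk : d * k ≤ t := hk ▸ Nat.mul_div_le t d
    have hdk' : t < d * k + d := by
      have := Nat.lt_mul_div_succ t hd
      rw [← hk, mul_add, mul_one] at this
      exact this
    have hkr : 2 * k + 1 ≤ r := by
      by_contra hc
      have : d * r ≤ d * (2 * k) := Nat.mul_le_mul_left d (by omega)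
      have h2 : d * (2 * k) = 2 * (d * k) := by ring
      omega
    rcases Nat.lt_or_ge n (d * k + d) with h | h
    · exact ⟨k, not_exists_iso_of_meet hr hkr hn h htn hdk hdvd⟩
    · refine ⟨k, not_exists_iso_of_disjoint hd hr hk1 hkr h ⟨0, by omega⟩
        ⟨t - d * k, by omega⟩ ?_⟩
      convert hdvd using 1
      push_cast [Nat.cast_sub hdk]
      ring

/-! ### Connectedness -/

theorem le_mul_of_connected {n d r : ℕ} [NeZero n] (hr : 3 ≤ r)
    (h : (generalRCR n d r).Connected) : n ≤ d * r := by
  have : NeZero r := ⟨by omega⟩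
  by_contra! hlt
  let f : ZMod r × Fin d → ZMod n := fun p =>
    (((p.2 : ℕ) + 1 : ℕ) : ZMod n) - (d : ZMod n) * (p.1.val : ZMod n)
  -- A coordinate outside all windows is constant along walks.
  obtain ⟨j, hj⟩ : ∃ j, ∀ p, f p ≠ j := by
    by_contra! hsurj
    have := Fintype.card_le_of_surjective f hsurj
    simp only [Fintype.card_prod, ZMod.card, Fintype.card_fin] at this
    rw [mul_comm] at this
    omega
  have hadj : ∀ u v, (generalRCR n d r).Adj u v → u.1 j = v.1 j := by
    intro u v huv
    obtain ⟨m, rfl⟩ := exists_move_of_adj huv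
    rcases m with b | i
    · rfl
    · have := hj (u.2, i)
      simp only [f] at this
      simp only [rcrStep, stdVec, Pi.add_apply, Pi.single_eq_of_ne this.symm, add_zero]
  have hwalk : ∀ u v, (generalRCR n d r).Walk u v → u.1 j = v.1 j := by
    intro u v p
    induction p with
    | nil => rfl
    | cons huv _ ih => exact (hadj _ _ huv).trans ih
  obtain ⟨p⟩ := h.preconnected (0, 0) (stdVec n j, 0)
  have := hwalk _ _ p
  simp [stdVec] at this

theorem reachable_ring {n d r : ℕ} (hr : 3 ≤ r) (a : ZMod n → ZMod 2) (x y : ZMod r) :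
    (generalRCR n d r).Reachable (a, x) (a, y) := by
  have : NeZero r := ⟨by omega⟩
  have h : ∀ k : ℕ, (generalRCR n d r).Reachable (a, x) (a, x + k) := by
    intro k
    induction k with
    | zero => simp
    | succ k ih =>
      refine ih.trans (SimpleGraph.Adj.reachable ?_)
      have := adj_rcrStep (n := n) (d := d) hr (Sum.inl true) (a, x + k)
      simpa [rcrStep, ringSign, add_assoc] using this
  simpa using h (y - x).val

theorem reachable_add_stdVec {n d r : ℕ} [NeZero n] (hd : 1 ≤ d) (hr : 3 ≤ r)
    (hle : n ≤ d * r) (a : ZMod n → ZMod 2) (j : ZMod n) (x : ZMod r) :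
    (generalRCR n d r).Reachable (a, x) (a + stdVec n j, x) := by
  -- Division of `d - j` by `d` gives the level `m / d` whose window contains `j`; `m < n ≤ dr`
  -- keeps it below `r`.
  obtain ⟨m, hm⟩ : ∃ m, m = (d - j : ZMod n).val := ⟨_, rfl⟩
  have hmn : m < n := hm ▸ ZMod.val_lt _
  have hmr : m / d < r := Nat.div_lt_of_lt_mul (by omega)
  have hmd := Nat.mod_lt m hd
  have hadj := adj_rcrStep (n := n) hr (Sum.inr (⟨d - 1 - m % d, by omega⟩ : Fin d))
    (a, ((m / d : ℕ) : ZMod r))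
  have hj : (((d - 1 - m % d : ℕ) + 1 : ℕ) : ZMod n) - d * ((m / d : ℕ) : ZMod n) = j := by
    have h1 : (d - 1 - m % d + 1 : ℕ) + m % d = d := by omega
    have h2 := Nat.div_add_mod m d
    have h3 : (m : ZMod n) = d - j := by rw [hm, ZMod.natCast_zmod_val]
    have h1' := congrArg (Nat.cast : ℕ → ZMod n) h1
    have h2' := congrArg (Nat.cast : ℕ → ZMod n) h2
    rw [h3] at h2'
    rw [Nat.cast_add] at h1'
    push_cast at h2'
    linear_combination h1' - h2'
  simp only [rcrStep, ZMod.val_natCast_of_lt hmr, hj] at hadj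
  exact (reachable_ring hr a x _).trans (hadj.reachable.trans (reachable_ring hr _ _ x))

theorem connected_of_le_mul {n d r : ℕ} [NeZero n] (hd : 1 ≤ d) (hr : 3 ≤ r)
    (hle : n ≤ d * r) : (generalRCR n d r).Connected := by
  have hadd : ∀ b c : ZMod n → ZMod 2, (generalRCR n d r).Reachable (c, 0) (c + b, 0) := by
    intro b
    have hb : ∑ j, Pi.single j (b j) = b := Finset.univ_sum_single b
    rw [← hb]
    refine Finset.sum_induction _
      (fun b => ∀ c, (generalRCR n d r).Reachable (c, 0) (c + b, 0)) ?_ ?_ ?_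
    · intro b b' h h' c
      rw [← add_assoc]
      exact (h c).trans (h' (c + b))
    · intro c
      simp
    · intro j _ c
      rcases (by decide : ∀ z : ZMod 2, z = 0 ∨ z = 1) (b j) with h | h
      · simp [h]
      · rw [h]
        exact reachable_add_stdVec hd hr hle c j 0
  have h0 : ∀ u, (generalRCR n d r).Reachable (0, 0) u := by
    rintro ⟨a, x⟩
    have := hadd a 0
    rw [zero_add] at this
    exact this.trans (reachable_ring hr a 0 x)
  have : Nonempty ((ZMod n → ZMod 2) × ZMod r) := ⟨(0, 0)⟩
  exact ⟨fun u v => (h0 u).symm.trans (h0 v)⟩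

/-! ### The Cayley representation -/

/-- The semidirect product of `ℤ₂ⁿ` and `ℤ_r` in which `x` rotates the coordinates by `θ x`. -/
@[ext]
structure RotationGroup {n r : ℕ} (θ : ZMod r →+ ZMod n) where
  /-- The component in `ℤ₂ⁿ`. -/
  vec : ZMod n → ZMod 2
  /-- The component in `ℤ_r`. -/
  level : ZMod r

namespace RotationGroup

variable {n r : ℕ} (θ : ZMod r →+ ZMod n)

instance : Mul (RotationGroup θ) :=
  ⟨fun u v => ⟨u.vec + fun k => v.vec (k + θ u.level), u.level + v.level⟩⟩

instance : Inv (RotationGroup θ) := ⟨fun u => ⟨fun k => -u.vec (k - θ u.level), -u.level⟩⟩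

instance : One (RotationGroup θ) := ⟨⟨0, 0⟩⟩

theorem mul_def (u v : RotationGroup θ) :
    u * v = ⟨u.vec + fun k => v.vec (k + θ u.level), u.level + v.level⟩ := rfl

theorem inv_def (u : RotationGroup θ) :
    u⁻¹ = ⟨fun k => -u.vec (k - θ u.level), -u.level⟩ := rfl

theorem one_def : (1 : RotationGroup θ) = ⟨0, 0⟩ := rfl

instance : Group (RotationGroup θ) :=
  Group.ofLeftAxioms
    (by
      intro u v w
      ext k
      · simp [mul_def, add_assoc]
      · simp [mul_def, add_assoc])
    (by
      intro u
      ext k <;> simp [mul_def, one_def])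
    (by
      intro u
      ext k
      · simp only [mul_def, inv_def, one_def, Pi.add_apply, map_neg, ← sub_eq_add_neg,
          neg_add_cancel, Pi.zero_apply]
      · simp [mul_def, inv_def, one_def])

/-- The underlying set is `ℤ₂ⁿ × ℤ_r`. -/
def equivProd : (ZMod n → ZMod 2) × ZMod r ≃ RotationGroup θ where
  toFun u := ⟨u.1, u.2⟩
  invFun u := (u.vec, u.level)

end RotationGroup

theorem isCayleyGraph_of_dvd {n d r : ℕ} (hr : 3 ≤ r) (h : n ∣ d * r) :
    IsCayleyGraph (generalRCR n d r) := by
  have : NeZero r := ⟨by omega⟩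
  have h10 : Fact (1 < r) := ⟨by omega⟩
  let θ : ZMod r →+ ZMod n := ZMod.lift r ⟨zmultiplesHom (ZMod n) (d : ZMod n), by
    have := (ZMod.natCast_eq_zero_iff (d * r) n).2 h
    push_cast at this
    simp [mul_comm, this]⟩
  have hθ : ∀ x : ZMod r, θ x = d * (x.val : ZMod n) := by
    intro x
    have h1 : θ ((x.val : ℤ) : ZMod r) = d * (x.val : ZMod n) := by
      simp only [θ, ZMod.lift_coe]
      simp [mul_comm]
    simpa using h1
  -- Hence right multiplication by `(e_i, 0)` at level `x` adds `e_{i - dx}`, exactly a cube edge.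
  have hrot : ∀ j t : ZMod n, (fun k => stdVec n j (k + t)) = stdVec n (j - t) := by
    intro j t
    funext k
    simp only [stdVec, Pi.single_apply, eq_sub_iff_add_eq]
  let S : Set (RotationGroup θ) :=
    {v | (v.vec = 0 ∧ (v.level = 1 ∨ v.level = -1)) ∨
      (v.level = 0 ∧ ∃ i : ℕ, 1 ≤ i ∧ i ≤ d ∧ v.vec = stdVec n i)}
  let E := RotationGroup.equivProd θ
  have hadj : ∀ u v, ∀ g ∈ S, u ≠ v → E u * g = E v → (generalRCR n d r).Adj u v := by
    rintro ⟨a, x⟩ ⟨a', x'⟩ ⟨b, y⟩ hg hne h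
    refine ⟨hne, ?_⟩
    simp only [E, RotationGroup.mul_def, RotationGroup.equivProd, Equiv.coe_fn_mk,
      RotationGroup.mk.injEq] at h
    obtain ⟨rfl, rfl⟩ := h
    rcases hg with ⟨hb, hy⟩ | ⟨hy, i, h1, h2, hb⟩
    · left
      simp only at hb hy
      subst hb
      refine ⟨by funext k; simp, ?_⟩
      rcases hy with rfl | rfl
      · right; simp
      · left; simp
    · right
      simp only at hb hy
      subst hb hy
      refine ⟨by simp, i, h1, h2, ?_⟩
      simp only [hrot, hθ]
  refine ⟨RotationGroup θ, inferInstance, S, ?_, ?_, ⟨⟨E, ?_⟩⟩⟩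
  · rw [RotationGroup.one_def]
    rintro (⟨-, h | h⟩ | ⟨-, i, -, -, h⟩)
    · exact zero_ne_one h
    · simp at h
    · exact stdVec_ne_zero n _ h.symm
  · rintro ⟨b, y⟩ hg
    rw [RotationGroup.inv_def]
    rcases hg with ⟨hb, hy⟩ | ⟨hy, i, h1, h2, hb⟩
    · left
      simp only at hb hy
      subst hb
      refine ⟨by funext k; simp, ?_⟩
      rcases hy with rfl | rfl <;> simp
    · right
      simp only at hb hy
      subst hb hy
      refine ⟨by simp, i, h1, h2, ?_⟩
      funext k
      simp
  · intro u v
    rw [SimpleGraph.mulCayley_adj', E.injective.ne_iff]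
    constructor
    · rintro ⟨hne, g, hg, h | h⟩
      · exact hadj u v g hg hne h
      · exact (hadj v u g hg hne.symm h.symm).symm
    · rintro ⟨hne, h⟩
      refine ⟨hne, ?_⟩
      obtain ⟨a, x⟩ := u
      obtain ⟨b, y⟩ := v
      rcases h with ⟨hab, hxy | hxy⟩ | ⟨hxy, i, h1, h2, hb⟩
      · refine ⟨⟨0, -1⟩, Or.inl ⟨rfl, Or.inr rfl⟩, Or.inl ?_⟩
        simp only at hab hxy
        subst hab hxy
        ext k <;> simp [RotationGroup.mul_def, E, RotationGroup.equivProd]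
      · refine ⟨⟨0, 1⟩, Or.inl ⟨rfl, Or.inl rfl⟩, Or.inl ?_⟩
        simp only at hab hxy
        subst hab hxy
        ext k <;> simp [RotationGroup.mul_def, E, RotationGroup.equivProd]
      · refine ⟨⟨stdVec n i, 0⟩, Or.inr ⟨rfl, i, h1, h2, rfl⟩, Or.inl ?_⟩
        simp only at hxy hb
        subst hxy hb
        simp only [RotationGroup.mul_def, E, RotationGroup.equivProd, Equiv.coe_fn_mk, hrot, hθ,
          add_zero]

theorem theoremA (n d r : ℕ) (hd : 1 ≤ d) (hr : 3 ≤ r) (hn : 2 * d ≤ n) :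
    ((generalRCR n d r).Connected ∧ IsCayleyGraph (generalRCR n d r)) ↔
      d * r ≡ 0 [MOD n] := by
  have : NeZero n := ⟨by omega⟩
  rw [Nat.modEq_zero_iff_dvd]
  constructor
  · rintro ⟨hconn, hcay⟩
    by_contra hnd
    obtain ⟨k, hk⟩ := exists_not_exists_iso hd hr hn (le_mul_of_connected hr hconn) hnd
    exact hk (hcay.exists_iso _ _)
  · intro h
    exact ⟨connected_of_le_mul hd hr (Nat.le_of_dvd (by positivity) h),
      isCayleyGraph_of_dvd hr h⟩
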